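/- All graphs are finite and simple, and $\log$ is the logarithm to base $2$. Distinct vertices of a graph are interpreted as confusable if they are adjacent. The strong product $G\boxtimes H$ has vertex set $V(G)\times V(H)$, two distinct pairs being adjacent iff in each coordinate they are equal or adjacent; $G^{\boxtimes n}$ is the $n$-fold strong power, with vertex set $V(G)^n$. Write $H\le G$ if there is a homomorphism $\overline{H}\to\overline{G}$ between the complements. A *spectral point* is a map $f$ from graphs to $\mathbb{R}_{\ge 0}$ with $f(G\sqcup H)=f(G)+f(H)$, $f(G\boxtimes H)=f(G)f(H)$, $f(H)\le f(G)$ whenever $H\le G$, and $f(\overline{K_d})=d$. An $n$-type on a finite set $\mathcal X$ is a probability distribution on $\mathcal X$ with values in $\frac1n\mathbb{Z}$; the type of $x\in\mathcal X^n$ is its empirical distribution. For a graph $G$ and an $n$-type $Q$ on $V(G)$ let $G^{\boxtimes n}[T^n_Q]$ be the subgraph of $G^{\boxtimes n}$ induced on the strings of type $Q$. The *logarithmic probabilistic refinement* of $f$ is $$F(G,P)=\lim_{n\to\infty}\frac1n\log f\bigl(G^{\boxtimes n}[T^n_{P^{(n)}}]\bigr),$$ where $P$ is a probability distribution on $V(G)$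 and $P^{(n)}$ is any sequence of $n$-types converging to $P$. For distributions $P,Q$ on $\mathcal X^n$, $n\ge1$, the Ornstein distance $\bar d(P,Q)$ is the minimum, over all couplings $R$ of $P$ and $Q$, of $\sum_{x,x'}R(x,x')\cdot\frac1n|\{i: x_i\ne x'_i\}|$. A probability measure $\mu$ on $\mathcal X^\infty$ (with the product $\sigma$-algebra of $2^{\mathcal X}$) with marginals $\mu_{12\ldots n}$ is stationary if $\mu_{m+1,\ldots,m+n}=\mu_{12\ldots n}$ for all $m,n$. Let $$\overline F(G,\mu)=\lim_{n\to\infty}\frac1nF(G^{\boxtimes n},\mu_{12\ldots n}),\qquad \bar d(\mu,\nu)=\lim_{n\to\infty}\bar d(\mu_{12\ldots n},\nu_{12\ldots n}).$$ Let $h(p)=-p\log p-(1-p)\log(1-p)$ and $\eta(t)=(1+t)h\bigl(\tfrac1{1+t}\bigr)$. **Proposition (continuity of the $F$-rate in the Ornstein distance).** Let $f$ be a spectral point with logarithmic probabilistic refinement $F$, and let $G$ be a graph. 0. $F$ is well defined: for every graph $H$ and every probability distribution $P$ on $V(H)$, the limit defining $F(H,P)$ exists and is the same for all sequences of $n$-types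 converging to $P$. 1. For every $n\ge1$ and all probability distributions $P,Q$ on $V(G)^n$, $$\left|\frac1nF(G^{\boxtimes n},P)-\frac1nF(G^{\boxtimes n},Q)\right|\le\bar d(P,Q)\log f(G)+2\eta(\bar d(P,Q)).$$ 2. If $\mu$ and $\nu$ are stationary probability measures on $V(G)^\infty$, then the limits defining $\overline F(G,\mu)$, $\overline F(G,\nu)$ and $\bar d(\mu,\nu)$ exist, and $$|\overline F(G,\mu)-\overline F(G,\nu)|\le\bar d(\mu,\nu)\log f(G)+2\eta(\bar d(\mu,\nu)).$$ -/

import Mathlib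

open Filter Topology MeasureTheory

noncomputable section

namespace AmbiguousSource

universe u

/-- The strong product of two confusability graphs: distinct pairs are adjacent iff they are
adjacent or equal in both coordinates. -/
def strongProd {V W : Type u} (G : SimpleGraph V) (H : SimpleGraph W) : SimpleGraph (V × W) where
  Adj x y := x ≠ y ∧ (x.1 = y.1 ∨ G.Adj x.1 y.1) ∧ (x.2 = y.2 ∨ H.Adj x.2 y.2)
  symm := ⟨fun _ _ h =>
    ⟨h.1.symm, h.2.1.imp Eq.symm (fun e => G.adj_symm e), h.2.2.imp Eq.symm (fun e => H.adj_symm e)⟩⟩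
  loopless := ⟨fun _ h => h.1 rfl⟩

/-- The `n`-fold strong power of a graph, on the set of strings of length `n`. -/
def strongPow {V : Type u} (G : SimpleGraph V) (n : ℕ) : SimpleGraph (Fin n → V) where
  Adj x y := x ≠ y ∧ ∀ i, x i = y i ∨ G.Adj (x i) (y i)
  symm := ⟨fun _ _ h => ⟨h.1.symm, fun i => (h.2 i).imp Eq.symm (fun e => G.adj_symm e)⟩⟩
  loopless := ⟨fun _ h => h.1 rfl⟩

/-- An element of the asymptotic spectrum of graphs: a nonnegative parameter of finite graphs that
is additive under disjoint union, multiplicative under the strong product, monotone under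
homomorphisms between complements, and equal to the number of vertices on edgeless graphs
(the complements of complete graphs). -/
structure SpectralPoint where
  val : ∀ {V : Type u} [Finite V], SimpleGraph V → ℝ
  nonneg : ∀ {V : Type u} [Finite V] (G : SimpleGraph V), 0 ≤ val G
  map_sum : ∀ {V W : Type u} [Finite V] [Finite W] (G : SimpleGraph V) (H : SimpleGraph W),
    val (G.sum H) = val G + val H
  map_strongProd : ∀ {V W : Type u} [Finite V] [Finite W] (G : SimpleGraph V) (H : SimpleGraph W),
    val (strongProd G H) = val G * val H
  mono : ∀ {V W : Type u} [Finite V] [Finite W] (H : SimpleGraph V) (G : SimpleGraph W),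
    Nonempty (Hᶜ →g Gᶜ) → val H ≤ val G
  map_edgeless : ∀ {V : Type u} [Finite V], val (⊥ : SimpleGraph V) = Nat.card V

open scoped Classical in
/-- The type (empirical distribution) of a string. -/
def typeOf {V : Type u} {n : ℕ} (x : Fin n → V) : V → ℝ :=
  fun a => ((Finset.univ.filter fun i => x i = a).card : ℝ) / n

/-- `Q` is an `n`-type: a probability distribution all of whose values are multiples of `1 / n`. -/
def IsNType {V : Type u} [Fintype V] (n : ℕ) (Q : V → ℝ) : Prop :=
  Q ∈ stdSimplex ℝ V ∧ ∀ a, ∃ k : ℕ, (n : ℝ) * Q a = k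

/-- The subgraph of the `n`-th strong power induced on the strings of type `Q`. -/
def typeGraph {V : Type u} (G : SimpleGraph V) (n : ℕ) (Q : V → ℝ) :
    SimpleGraph {x : Fin n → V | typeOf x = Q} :=
  (strongPow G n).induce {x : Fin n → V | typeOf x = Q}

/-- `L` is the common limit of `(1 / n) log f` of the type graphs, along every sequence of
`n`-types that converges to `P`. -/
def IsRefinementLimit {V : Type u} [Fintype V] (f : SpectralPoint.{u}) (G : SimpleGraph V)
    (P : V → ℝ) (L : ℝ) : Prop :=
  ∀ Q : ℕ → V → ℝ, (∀ n, IsNType n (Q n)) → Tendsto Q atTop (𝓝 P) →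
    Tendsto (fun n : ℕ => 1 / (n : ℝ) * Real.logb 2 (f.val (typeGraph G n (Q n)))) atTop (𝓝 L)

/-- The logarithmic probabilistic refinement `F(G, P)` of the spectral point `f`. -/
def refinement {V : Type u} [Fintype V] (f : SpectralPoint.{u}) (G : SimpleGraph V)
    (P : V → ℝ) : ℝ :=
  Classical.epsilon (IsRefinementLimit f G P)

/-- `R` is a coupling of `P` and `Q`. -/
def IsCoupling {X : Type u} [Fintype X] (P Q : X → ℝ) (R : X × X → ℝ) : Prop :=
  R ∈ stdSimplex ℝ (X × X) ∧ (∀ x, ∑ y, R (x, y) = P x) ∧ (∀ y, ∑ x, R (x, y) = Q y)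

/-- The Wasserstein distance of two distributions on a finite set. The set of values is the
continuous image of a compact set of couplings, so the infimum is a minimum. -/
def wasserstein {X : Type u} [Fintype X] (d : X → X → ℝ) (P Q : X → ℝ) : ℝ :=
  sInf {c : ℝ | ∃ R : X × X → ℝ, IsCoupling P Q R ∧ c = ∑ x, ∑ y, R (x, y) * d x y}

open scoped Classical in
/-- The normalized Hamming distance on strings of length `n`. -/
def normHamming {V : Type u} {n : ℕ} (x y : Fin n → V) : ℝ :=
  1 / (n : ℝ) * ((Finset.univ.filter fun i => x i ≠ y i).card : ℝ)

/-- The Ornstein distance of two distributions on strings of length `n`. -/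
def dbar {V : Type u} [Fintype V] {n : ℕ} (P Q : (Fin n → V) → ℝ) : ℝ :=
  wasserstein normHamming P Q

/-- The joint distribution of the `n` letters that follow the first `m` letters. -/
def marginal {V : Type u} [MeasurableSpace V] (μ : Measure (ℕ → V)) (m n : ℕ) :
    (Fin n → V) → ℝ :=
  fun x => μ.real {w : ℕ → V | ∀ i : Fin n, w (m + i) = x i}

/-- The joint distribution of the first `n` letters. -/
def initialMarginal {V : Type u} [MeasurableSpace V] (μ : Measure (ℕ → V)) (n : ℕ) :
    (Fin n → V) → ℝ :=
  marginal μ 0 n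

/-- Stationarity: the joint distribution of a block does not depend on its position. -/
def IsStationary {V : Type u} [MeasurableSpace V] (μ : Measure (ℕ → V)) : Prop :=
  ∀ m n, marginal μ m n = initialMarginal μ n

/-- The Ornstein distance of two stationary measures on infinite words. -/
def dbarInfinite {V : Type u} [Fintype V] [MeasurableSpace V] (μ ν : Measure (ℕ → V)) : ℝ :=
  limUnder atTop fun n : ℕ => dbar (initialMarginal μ n) (initialMarginal ν n)

/-- The `F`-rate of a graph and a measure on infinite words. -/
def rate {V : Type u} [Fintype V] [MeasurableSpace V] (f : SpectralPoint.{u})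
    (G : SimpleGraph V) (μ : Measure (ℕ → V)) : ℝ :=
  limUnder atTop fun n : ℕ => 1 / (n : ℝ) * refinement f (strongPow G n) (initialMarginal μ n)

/-- The binary entropy function, with logarithms to base two. -/
def binaryEntropy (p : ℝ) : ℝ :=
  -p * Real.logb 2 p - (1 - p) * Real.logb 2 (1 - p)

/-- The function `η(t) = (1 + t) h(1 / (1 + t))`. -/
def eta (t : ℝ) : ℝ :=
  (1 + t) * binaryEntropy (1 / (1 + t))

end AmbiguousSource

end

/-!
The functional `F` is controlled by one estimate. If every string of a set `A` of strings of
length `M` can be moved into a set `B` by changing exactly `D` of its letters, then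
`f(G^M[A]) ≤ (M choose D) f(G)^D f(G^M[B])`: up to confusability a string of `A` is recovered from
the set of changed positions, the original letters there, and the resulting string of `B`
(`SpectralPoint.val_le_choose_mul`). The binomial coefficient is at most `2 ^ (M η(D / M))`
(`logb_choose_le`). A joint type of `N` pairs of blocks with marginal types `P` and `Q` moves the
type class of `P` into that of `Q` in this way (`classVal_map_fst_le`), where `D` is `N` times the
expected Hamming distance of a pair.

The refinement exists because the values of type classes are supermultiplicative under
concatenation: repeating a type of length `n` shows that the rate at length `n` is asymptotically
a lower bound for the rates at all large lengths (`eventually_classRate_le`), and the estimate above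
shows that passing between nearby types costs little. Hence the upper limit along any sequence of
types is at most the lower limit along any other one.

Approximating a coupling of `P` and `Q` by joint types gives the continuity bound for strings of
length `n` (`abs_refinement_sub_le`), even with `η` in place of `2 η`. For stationary
measures, `F(G^n, μ_{1…n})` is subadditive in `n` (`refinement_le_add`) and `n` times the Ornstein
distance of the marginals is superadditive (`dbar_superadditive`), so the limits exist by Fekete's
lemma, and the bound passes to the limit.

Types are encoded as multisets of letters, whose multiplicities are the unnormalized frequencies;
concatenation of strings is then addition of multisets.
-/

open Filter Topology MeasureTheory

noncomputable section

namespace AmbiguousSource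

universe u

/-! ### Spectral points under maps that preserve distinguishability -/

theorem compl_strongProd_adj {V W : Type u} (G : SimpleGraph V) (H : SimpleGraph W)
    (x y : V × W) :
    (strongProd G H)ᶜ.Adj x y ↔ Gᶜ.Adj x.1 y.1 ∨ Hᶜ.Adj x.2 y.2 := by
  simp only [SimpleGraph.compl_adj, strongProd, ne_eq, Prod.ext_iff]
  tauto

theorem compl_strongPow_adj {V : Type u} (G : SimpleGraph V) (n : ℕ) (x y : Fin n → V) :
    (strongPow G n)ᶜ.Adj x y ↔ ∃ i, Gᶜ.Adj (x i) (y i) := by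
  simp only [SimpleGraph.compl_adj, strongPow]
  constructor
  · rintro ⟨hne, h⟩
    by_contra! hc
    exact h ⟨hne, fun i => by have := hc i; tauto⟩
  · rintro ⟨i, hne, h⟩
    refine ⟨fun e => hne (congrFun e i), fun h' => ?_⟩
    have := h'.2 i
    tauto

theorem compl_induce_adj {V : Type u} (G : SimpleGraph V) (s : Set V) (x y : s) :
    (G.induce s)ᶜ.Adj x y ↔ Gᶜ.Adj x.1 y.1 := by
  simp [SimpleGraph.compl_adj, Subtype.ext_iff]

namespace SpectralPoint

theorem val_le_of_map {V W : Type u} [Finite V] [Finite W] (f : SpectralPoint.{u})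
    {G : SimpleGraph V} {H : SimpleGraph W} (φ : V → W)
    (h : ∀ x y, Gᶜ.Adj x y → Hᶜ.Adj (φ x) (φ y)) : f.val G ≤ f.val H :=
  f.mono G H ⟨⟨φ, fun e => h _ _ e⟩⟩

theorem one_le_val {V : Type u} [Finite V] [Nonempty V] (f : SpectralPoint.{u})
    (G : SimpleGraph V) : 1 ≤ f.val G := by
  have h := f.map_edgeless (V := PUnit.{u + 1})
  rw [Nat.card_unique, Nat.cast_one] at h
  rw [← h]
  exact f.val_le_of_map (fun _ => Classical.arbitrary V) (fun x y e => absurd rfl e.ne)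

theorem val_le_one {V : Type u} [Finite V] [Subsingleton V] (f : SpectralPoint.{u})
    (G : SimpleGraph V) : f.val G ≤ 1 := by
  have h := f.map_edgeless (V := PUnit.{u + 1})
  rw [Nat.card_unique, Nat.cast_one] at h
  rw [← h]
  exact f.val_le_of_map (fun _ => PUnit.unit)
    (fun x y e => absurd (Subsingleton.elim x y) e.ne)

/-- Equality holds, but only the upper bound is needed. -/
theorem val_strongPow_le {V : Type u} [Finite V] (f : SpectralPoint.{u}) (G : SimpleGraph V)
    (n : ℕ) : f.val (strongPow G n) ≤ f.val G ^ n := by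
  induction n with
  | zero => simpa using f.val_le_one (strongPow G 0)
  | succ n ih =>
    calc f.val (strongPow G (n + 1)) ≤ f.val (strongProd G (strongPow G n)) := by
          refine f.val_le_of_map (fun x => (x 0, Fin.tail x)) fun x y h => ?_
          rw [compl_strongPow_adj, Fin.exists_fin_succ] at h
          rw [compl_strongProd_adj, compl_strongPow_adj]
          exact h
      _ = f.val G * f.val (strongPow G n) := f.map_strongProd _ _
      _ ≤ f.val G * f.val G ^ n := mul_le_mul_of_nonneg_left ih (f.nonneg G)
      _ = f.val G ^ (n + 1) := by ring

open scoped Classical in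
/-- Let the vertices of `K` and `K'` be labelled by words over the vertices of `G`, and let `q`
move the label of every vertex of `K` by Hamming distance exactly `D`. A vertex `x` of `K` can be
recovered, up to confusability, from the set of positions where its label is changed, the `D`
original letters there, and `q x`. -/
theorem val_le_choose_mul {X Y V : Type u} [Finite X] [Finite Y] [Finite V] {ι : Type} [Fintype ι]
    (f : SpectralPoint.{u}) {K : SimpleGraph X} {K' : SimpleGraph Y} (G : SimpleGraph V)
    (p : X → ι → V) (q : X → Y) (r : Y → ι → V) (D : ℕ)
    (hp : ∀ x x', Kᶜ.Adj x x' → ∃ i, Gᶜ.Adj (p x i) (p x' i))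
    (hr : ∀ y y' i, Gᶜ.Adj (r y i) (r y' i) → K'ᶜ.Adj y y')
    (hD : ∀ x, hammingDist (p x) (r (q x)) = D) :
    f.val K ≤ (Fintype.card ι).choose D * (f.val G ^ D * f.val K') := by
  let S : X → {S : Finset ι // S.card = D} := fun x =>
    ⟨Finset.univ.filter fun i => p x i ≠ r (q x) i, hD x⟩
  let e : {S : Finset ι // S.card = D} → Fin D → ι := fun T j =>
    ((T.1.equivFinOfCardEq T.2).symm j : T.1)
  have he : ∀ T i, i ∈ T.1 → ∃ j, e T j = i := fun T i hi =>
    ⟨T.1.equivFinOfCardEq T.2 ⟨i, hi⟩, by simp [e]⟩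
  have hcard : f.val (⊥ : SimpleGraph (ULift.{u} {S : Finset ι // S.card = D}))
      = (Fintype.card ι).choose D := by
    rw [f.map_edgeless, Nat.card_eq_fintype_card, Fintype.card_ulift, Fintype.card_finset_len]
  calc f.val K ≤ f.val (strongProd (⊥ : SimpleGraph (ULift.{u} {S : Finset ι // S.card = D}))
          (strongProd (strongPow G D) K')) := by
        refine f.val_le_of_map (fun x => (ULift.up (S x), (fun j => p x (e (S x) j), q x)))
          fun x x' h => ?_
        rw [compl_strongProd_adj, compl_strongProd_adj, compl_strongPow_adj]
        by_cases hS : S x = S x'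
        · right
          obtain ⟨i, hi⟩ := hp x x' h
          by_cases hiS : i ∈ (S x).1
          · left
            obtain ⟨j, hj⟩ := he _ i hiS
            refine ⟨j, ?_⟩
            simp only
            rw [← hS, hj]
            exact hi
          · right
            have hiS' : i ∉ (S x').1 := hS ▸ hiS
            simp only [S, Finset.mem_filter, Finset.mem_univ, true_and, not_not] at hiS hiS'
            rw [hiS, hiS'] at hi
            exact hr _ _ i hi
        · left
          simpa using hS
    _ = (Fintype.card ι).choose D * (f.val (strongPow G D) * f.val K') := by
        rw [f.map_strongProd, f.map_strongProd, hcard]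
    _ ≤ (Fintype.card ι).choose D * (f.val G ^ D * f.val K') :=
        mul_le_mul_of_nonneg_left
          (mul_le_mul_of_nonneg_right (f.val_strongPow_le G D) (f.nonneg K')) (Nat.cast_nonneg _)

end SpectralPoint

/-! ### The entropy bound on binomial coefficients -/

theorem eta_eq {t : ℝ} (ht : 0 ≤ t) :
    eta t = (1 + t) * Real.logb 2 (1 + t) - t * Real.logb 2 t := by
  have h1 : (1 + t) ≠ 0 := by positivity
  rcases ht.eq_or_lt with rfl | h
  · simp [eta, binaryEntropy]
  · have h2 : 1 - 1 / (1 + t) = t / (1 + t) := by field_simp; ring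
    rw [eta, binaryEntropy, h2, Real.logb_div one_ne_zero h1, Real.logb_div h.ne' h1, Real.logb_one]
    field_simp
    ring

theorem continuousOn_eta : ContinuousOn eta (Set.Ici 0) := by
  have h : Continuous fun t : ℝ => (1 + t) * Real.logb 2 (1 + t) - t * Real.logb 2 t := by
    have h1 : Continuous fun t : ℝ => t * Real.logb 2 t := by
      simp only [Real.logb, ← mul_div_assoc]
      exact Real.continuous_mul_log.div_const _
    exact (h1.comp (continuous_const.add continuous_id)).sub h1
  exact h.continuousOn.congr fun t ht => eta_eq ht

theorem eta_zero : eta 0 = 0 := by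
  simp [eta_eq le_rfl]

/-- One term of the binomial expansion of `(1 + t) ^ M` with `t = D / M` is at most the sum. -/
theorem logb_choose_le (M D : ℕ) :
    Real.logb 2 (M.choose D) ≤ M * eta (D / M) := by
  rcases Nat.eq_zero_or_pos M with rfl | hM
  · rcases D with _ | D <;> simp
  rcases Nat.eq_zero_or_pos D with rfl | hD
  · simp [eta_zero]
  rcases lt_or_ge M D with hlt | hle
  -- for `M < D` the left side is `logb 2 0 = 0`
  · rw [Nat.choose_eq_zero_of_lt hlt]
    have ht : (1 : ℝ) ≤ D / M := by
      rw [one_le_div (by positivity)]; exact_mod_cast hlt.le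
    rw [eta_eq (by positivity)]
    have h1 : Real.logb 2 (D / M : ℝ) ≤ Real.logb 2 (1 + D / M) :=
      Real.logb_le_logb_of_le one_lt_two (by positivity) (by linarith)
    have h2 : 0 ≤ Real.logb 2 (D / M : ℝ) := Real.logb_nonneg one_lt_two ht
    simp only [Nat.cast_zero, Real.logb_zero]
    apply mul_nonneg (by positivity)
    nlinarith
  set t : ℝ := D / M with ht
  have htpos : 0 < t := by positivity
  have hch : (0 : ℝ) < M.choose D := by exact_mod_cast Nat.choose_pos hle
  have hMt : (M : ℝ) * t = D := by rw [ht]; field_simp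
  have h1 : (M.choose D : ℝ) * t ^ D ≤ (1 + t) ^ M := by
    rw [add_comm, add_pow]
    refine le_trans (le_of_eq ?_) (Finset.single_le_sum (f := fun k =>
      t ^ k * 1 ^ (M - k) * (M.choose k : ℝ)) (fun k _ => by positivity)
      (Finset.mem_range.2 (Nat.lt_succ_of_le hle)))
    simp [mul_comm]
  have h2 := Real.logb_le_logb_of_le one_lt_two (by positivity) h1
  rw [Real.logb_mul hch.ne' (by positivity), Real.logb_pow, Real.logb_pow] at h2
  have h3 : 0 ≤ Real.logb 2 (1 + t) := Real.logb_nonneg one_lt_two (by linarith)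
  rw [eta_eq htpos.le]
  have h4 : 0 ≤ (D : ℝ) * Real.logb 2 (1 + t) := by positivity
  calc Real.logb 2 (M.choose D) ≤ M * Real.logb 2 (1 + t) + D * Real.logb 2 (1 + t)
        - D * Real.logb 2 t := by linarith
    _ = M * ((1 + t) * Real.logb 2 (1 + t) - t * Real.logb 2 t) := by rw [← hMt]; ring

theorem eta_nonneg {t : ℝ} (ht : 0 ≤ t) : 0 ≤ eta t := by
  rw [eta_eq ht]
  rcases ht.eq_or_lt with rfl | h
  · simp
  have h1 : Real.logb 2 t ≤ Real.logb 2 (1 + t) :=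
    Real.logb_le_logb_of_le one_lt_two h (by linarith)
  have h2 : 0 ≤ Real.logb 2 (1 + t) := Real.logb_nonneg one_lt_two (by linarith)
  nlinarith

/-! ### Type classes of strings, indexed by multisets -/

/-- The value of `f` on the subgraph of the `n`-th strong power of `H` induced on the strings whose
multiset of letters is `s`. It is an (unnormalized) type graph; it has no vertices unless `s` has
cardinality `n`. -/
def classVal {W : Type u} [Finite W] (f : SpectralPoint.{u}) (H : SimpleGraph W) (n : ℕ)
    (s : Multiset W) : ℝ :=
  f.val ((strongPow H n).induce {x : Fin n → W | (List.ofFn x : Multiset W) = s})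

theorem exists_ofFn_eq {W : Type u} {n : ℕ} {s : Multiset W} (h : s.card = n) :
    ∃ x : Fin n → W, (List.ofFn x : Multiset W) = s := by
  subst h
  exact Quotient.inductionOn s fun l => ⟨l.get, by simp⟩

/-- If the image of a multiset `v` is the multiset of letters of `x`, then the elements of `v` can
be arranged in an order that lifts `x`. For `φ = Prod.fst` and a joint type `v`, this completes `x`
to a pair of strings of that joint type. -/
theorem exists_lift_ofFn {α β : Type u} (φ : α → β) {n : ℕ} (x : Fin n → β) (v : Multiset α)
    (h : (List.ofFn x : Multiset β) = v.map φ) :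
    ∃ z : Fin n → α, φ ∘ z = x ∧ (List.ofFn z : Multiset α) = v := by
  induction n generalizing v with
  | zero =>
    have hv : v = 0 := by simpa using h.symm
    exact ⟨Fin.elim0, Subsingleton.elim _ _, by simp [hv]⟩
  | succ n ih =>
    rw [List.ofFn_succ, ← Multiset.cons_coe] at h
    have hmem : x 0 ∈ v.map φ := h ▸ Multiset.mem_cons_self _ _
    obtain ⟨a, ha, hax⟩ := Multiset.mem_map.1 hmem
    obtain ⟨v', rfl⟩ := Multiset.exists_cons_of_mem ha
    rw [Multiset.map_cons, hax, Multiset.cons_inj_right] at h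
    obtain ⟨z, hz, hv⟩ := ih _ v' h
    refine ⟨Fin.cons a z, ?_, ?_⟩
    · funext i
      refine Fin.cases ?_ (fun j => ?_) i
      · simpa using hax
      · simpa using congrFun hz j
    · simp [List.ofFn_succ, ← Multiset.cons_coe, hv]

theorem classVal_nonneg {W : Type u} [Finite W] (f : SpectralPoint.{u}) (H : SimpleGraph W) (n : ℕ)
    (s : Multiset W) : 0 ≤ classVal f H n s :=
  f.nonneg _

theorem one_le_classVal {W : Type u} [Finite W] (f : SpectralPoint.{u}) (H : SimpleGraph W) {n : ℕ}
    {s : Multiset W} (h : s.card = n) : 1 ≤ classVal f H n s := by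
  obtain ⟨x, hx⟩ := exists_ofFn_eq h
  have : Nonempty {x : Fin n → W | (List.ofFn x : Multiset W) = s} := ⟨⟨x, hx⟩⟩
  exact f.one_le_val _

theorem classVal_le_pow {W : Type u} [Finite W] (f : SpectralPoint.{u}) (H : SimpleGraph W) (n : ℕ)
    (s : Multiset W) : classVal f H n s ≤ f.val H ^ n :=
  (f.val_le_of_map Subtype.val fun x y h => (compl_induce_adj _ _ x y).1 h).trans
    (f.val_strongPow_le H n)

/-- Supermultiplicativity: concatenation adds the multisets of letters. -/
theorem classVal_mul_le {W : Type u} [Finite W] (f : SpectralPoint.{u}) (H : SimpleGraph W)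
    (m n : ℕ) (s t : Multiset W) :
    classVal f H m s * classVal f H n t ≤ classVal f H (m + n) (s + t) := by
  rw [classVal, classVal, ← f.map_strongProd]
  refine f.val_le_of_map (fun z => ⟨Fin.append z.1.1 z.2.1, ?_⟩) fun z z' h => ?_
  · have h1 : (List.ofFn z.1.1 : Multiset W) = s := z.1.2
    have h2 : (List.ofFn z.2.1 : Multiset W) = t := z.2.2
    simp [List.ofFn_fin_append, ← Multiset.coe_add, h1, h2]
  · rw [compl_strongProd_adj, compl_induce_adj, compl_induce_adj, compl_strongPow_adj,
      compl_strongPow_adj] at h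
    rw [compl_induce_adj, compl_strongPow_adj]
    rcases h with ⟨i, hi⟩ | ⟨i, hi⟩
    · exact ⟨Fin.castAdd n i, by simpa using hi⟩
    · exact ⟨Fin.natAdd m i, by simpa using hi⟩

theorem classVal_pow_le {W : Type u} [Finite W] (f : SpectralPoint.{u}) (H : SimpleGraph W)
    (n q : ℕ) (s : Multiset W) :
    classVal f H n s ^ q ≤ classVal f H (q * n) (q • s) := by
  induction q with
  | zero =>
    rw [pow_zero]
    exact one_le_classVal f H (by simp)
  | succ q ih =>
    rw [pow_succ, Nat.succ_mul, succ_nsmul]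
    exact (mul_le_mul_of_nonneg_right ih (classVal_nonneg f H n s)).trans
      (classVal_mul_le f H _ _ _ _)

/-- Subadditivity: a string over the vertices of `K`, each of which is distinguished by its two
components in `H₁` and `H₂`, is determined up to confusability by its two component strings. -/
theorem classVal_le_mul {X Y Z : Type u} [Finite X] [Finite Y] [Finite Z] (f : SpectralPoint.{u})
    {K : SimpleGraph Z} {H₁ : SimpleGraph X} {H₂ : SimpleGraph Y} (a : Z → X) (b : Z → Y)
    (h : ∀ z z', Kᶜ.Adj z z' → H₁ᶜ.Adj (a z) (a z') ∨ H₂ᶜ.Adj (b z) (b z'))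
    (n : ℕ) (v : Multiset Z) :
    classVal f K n v ≤ classVal f H₁ n (v.map a) * classVal f H₂ n (v.map b) := by
  rw [classVal, classVal, classVal, ← f.map_strongProd]
  refine f.val_le_of_map (fun z => (⟨a ∘ z.1, ?_⟩, ⟨b ∘ z.1, ?_⟩)) fun z z' hz => ?_
  · have h1 : (List.ofFn z.1 : Multiset Z) = v := z.2
    simp [← h1, List.map_ofFn]
  · have h1 : (List.ofFn z.1 : Multiset Z) = v := z.2
    simp [← h1, List.map_ofFn]
  · rw [compl_induce_adj, compl_strongPow_adj] at hz
    rw [compl_strongProd_adj, compl_induce_adj, compl_induce_adj, compl_strongPow_adj,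
      compl_strongPow_adj]
    obtain ⟨i, hi⟩ := hz
    exact (h _ _ hi).imp (fun e => ⟨i, e⟩) (fun e => ⟨i, e⟩)

open scoped Classical in
/-- Two type classes with a joint type `v`: if the vertices of `H` are words over the vertices of
`G`, distinguishable exactly when some letter is, then every string of the first class can be moved
into the second one by changing as many letters as the pairs in `v` do in total. -/
theorem classVal_map_fst_le {V X : Type u} [Finite V] [Finite X] {κ : Type} [Fintype κ]
    (f : SpectralPoint.{u}) (G : SimpleGraph V) {H : SimpleGraph X} (p : X → κ → V)
    (hp : ∀ x y, Hᶜ.Adj x y ↔ ∃ i, Gᶜ.Adj (p x i) (p y i)) (n : ℕ) (v : Multiset (X × X)) :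
    classVal f H n (v.map Prod.fst)
      ≤ (n * Fintype.card κ).choose (v.map fun z => hammingDist (p z.1) (p z.2)).sum
        * (f.val G ^ (v.map fun z => hammingDist (p z.1) (p z.2)).sum
          * classVal f H n (v.map Prod.snd)) := by
  choose z hz hzv using fun x : {x : Fin n → X | (List.ofFn x : Multiset X) = v.map Prod.fst} =>
    exists_lift_ofFn Prod.fst x.1 v x.2
  have hι : n * Fintype.card κ = Fintype.card (Fin n × κ) := by simp
  rw [hι]
  have hq : ∀ x, (List.ofFn (Prod.snd ∘ z x) : Multiset X) = v.map Prod.snd := fun x => by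
    conv_rhs => rw [← hzv x]
    rw [Multiset.map_coe, List.map_ofFn]
  refine f.val_le_choose_mul G (fun x (i : Fin n × κ) => p (x.1 i.1) i.2)
    (fun x => ⟨Prod.snd ∘ z x, hq x⟩) (fun y i => p (y.1 i.1) i.2) _ ?_ ?_ ?_
  · intro x x' h
    rw [compl_induce_adj, compl_strongPow_adj] at h
    obtain ⟨j, hj⟩ := h
    obtain ⟨i, hi⟩ := (hp _ _).1 hj
    exact ⟨(j, i), hi⟩
  · intro y y' i h
    rw [compl_induce_adj, compl_strongPow_adj]
    exact ⟨i.1, (hp _ _).2 ⟨i.2, h⟩⟩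
  · intro x
    conv_rhs => rw [← hzv x]
    have hx : ∀ j, x.1 j = (z x j).1 := fun j => (congrFun (hz x) j).symm
    simp only [hammingDist, hx, Function.comp, Multiset.map_coe, List.map_ofFn, Multiset.sum_coe,
      List.sum_ofFn, Finset.card_filter, Fintype.sum_prod_type]

open scoped Classical in
/-- `classVal_map_fst_le` in logarithmic form; `t` is the average Hamming distance per letter of
`G` under the joint type. -/
theorem logb_classVal_map_fst_le {V X : Type u} [Finite V] [Finite X] [Nonempty V] {κ : Type}
    [Fintype κ] [Nonempty κ] (f : SpectralPoint.{u}) (G : SimpleGraph V) {H : SimpleGraph X}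
    (p : X → κ → V) (hp : ∀ x y, Hᶜ.Adj x y ↔ ∃ i, Gᶜ.Adj (p x i) (p y i)) {n : ℕ} (hn : 0 < n)
    (v : Multiset (X × X)) (hv : v.card = n) (t : ℝ)
    (ht : t = ((v.map fun z => hammingDist (p z.1) (p z.2)).sum : ℕ) / (n * Fintype.card κ : ℕ)) :
    Real.logb 2 (classVal f H n (v.map Prod.fst))
      ≤ (n * Fintype.card κ : ℕ) * (t * Real.logb 2 (f.val G) + eta t)
        + Real.logb 2 (classVal f H n (v.map Prod.snd)) := by
  set D := (v.map fun z => hammingDist (p z.1) (p z.2)).sum with hD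
  set M := n * Fintype.card κ with hM
  have hMpos : 0 < M := Nat.mul_pos hn Fintype.card_pos
  have h := classVal_map_fst_le f G p hp n v
  rw [← hD, ← hM] at h
  have h1 : 0 < classVal f H n (v.map Prod.fst) :=
    zero_lt_one.trans_le (one_le_classVal f H (by simpa using hv))
  have h2 : 0 < classVal f H n (v.map Prod.snd) :=
    zero_lt_one.trans_le (one_le_classVal f H (by simpa using hv))
  have hG : 0 < f.val G := zero_lt_one.trans_le (f.one_le_val G)
  have hch : (0 : ℝ) < M.choose D := by
    by_contra! hc
    have h3 : (M.choose D : ℝ) * (f.val G ^ D * classVal f H n (v.map Prod.snd)) ≤ 0 :=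
      mul_nonpos_of_nonpos_of_nonneg hc (by positivity)
    linarith
  have h3 := Real.logb_le_logb_of_le one_lt_two h1 h
  rw [Real.logb_mul hch.ne' (by positivity), Real.logb_mul (by positivity) h2.ne',
    Real.logb_pow] at h3
  have h4 := logb_choose_le M D
  rw [← ht] at h4
  have h5 : (D : ℝ) = M * t := by rw [ht]; field_simp
  rw [h5] at h3
  linarith

/-! ### Comparing nearby type classes -/

open scoped Classical in
/-- An optimal joint type for the discrete distance: match the common part of `s` and `t` with
itself, and pair the remaining letters arbitrarily. -/
theorem exists_joint_multiset {W : Type u} (s t : Multiset W) (h : s.card = t.card) :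
    ∃ v : Multiset (W × W), v.map Prod.fst = s ∧ v.map Prod.snd = t ∧
      (v.map fun z => hammingDist (fun _ : Unit => z.1) (fun _ : Unit => z.2)).sum
        ≤ (s - t).card := by
  have hs : s ∩ t + (s - t) = s := by
    rw [add_comm]; exact Multiset.sub_add_inter s t
  have ht : s ∩ t + (t - s) = t := by
    rw [add_comm, Multiset.inter_comm]; exact Multiset.sub_add_inter t s
  have hcard : (s - t).card = (t - s).card := by
    have h1 := congrArg Multiset.card hs
    have h2 := congrArg Multiset.card ht
    rw [Multiset.card_add] at h1 h2
    omega
  have hl : (s - t).toList.length = (t - s).toList.length := by simpa using hcard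
  refine ⟨(s ∩ t).map (fun a => (a, a)) + ((s - t).toList.zip (t - s).toList : List (W × W)),
    ?_, ?_, ?_⟩
  · rw [Multiset.map_add, Multiset.map_map, Multiset.map_coe, List.map_fst_zip hl.le]
    simpa using hs
  · rw [Multiset.map_add, Multiset.map_map, Multiset.map_coe, List.map_snd_zip hl.ge]
    simpa using ht
  · rw [Multiset.map_add, Multiset.sum_add, Multiset.map_map]
    have h1 : ((s ∩ t).map ((fun z : W × W => hammingDist (fun _ : Unit => z.1)
        (fun _ : Unit => z.2)) ∘ fun a => (a, a))).sum = 0 := by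
      refine Multiset.sum_eq_zero fun x hx => ?_
      obtain ⟨a, -, rfl⟩ := Multiset.mem_map.1 hx
      exact hammingDist_self _
    rw [h1, zero_add]
    refine (Multiset.sum_le_card_nsmul _ 1 ?_).trans ?_
    · intro x hx
      obtain ⟨z, -, rfl⟩ := Multiset.mem_map.1 hx
      simpa using hammingDist_le_card_fintype (x := fun _ : Unit => z.1) (y := fun _ : Unit => z.2)
    · simp [hcard]

theorem card_sub_le_sum {W : Type u} [Fintype W] [DecidableEq W] (s t : Multiset W) :
    ((s - t).card : ℝ) ≤ ∑ a, |(s.count a : ℝ) - t.count a| := by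
  rw [← Multiset.sum_count_eq_card (s := Finset.univ) (m := s - t) (fun a _ => Finset.mem_univ a)]
  push_cast
  refine Finset.sum_le_sum fun a _ => ?_
  rw [Multiset.count_sub]
  rcases le_total (s.count a) (t.count a) with h | h
  · rw [Nat.sub_eq_zero_of_le h]; simp
  · rw [Nat.cast_sub h]; exact le_abs_self _

open scoped Classical in
/-- The value of a type class varies continuously with the type: `d` is at most the `ℓ¹` distance of
the two empirical distributions. -/
theorem logb_classVal_le {W : Type u} [Fintype W] [Nonempty W] (f : SpectralPoint.{u})
    (H : SimpleGraph W) {n : ℕ} (hn : 0 < n) {s t : Multiset W} (hs : s.card = n)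
    (ht : t.card = n) :
    ∃ d : ℝ, 0 ≤ d ∧ d ≤ (∑ a, |(s.count a : ℝ) / n - t.count a / n|) ∧
      1 / (n : ℝ) * Real.logb 2 (classVal f H n s) ≤ (d * Real.logb 2 (f.val H) + eta d)
        + 1 / (n : ℝ) * Real.logb 2 (classVal f H n t) := by
  obtain ⟨v, rfl, rfl, hv⟩ := exists_joint_multiset s t (hs.trans ht.symm)
  have hn' : (0 : ℝ) < n := by exact_mod_cast hn
  refine ⟨((v.map fun z => hammingDist (fun _ : Unit => z.1) (fun _ : Unit => z.2)).sum : ℕ) / n,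
    by positivity, ?_, ?_⟩
  rotate_left
  · have h := logb_classVal_map_fst_le f H (H := H) (fun x (_ : Unit) => x) (by simp) hn v
      (by simpa using hs) _ rfl
    simp only [Fintype.card_unit, mul_one] at h
    have h2 := mul_le_mul_of_nonneg_left h (by positivity : 0 ≤ 1 / (n : ℝ))
    rw [mul_add, ← mul_assoc, one_div_mul_cancel hn'.ne', one_mul] at h2
    exact h2
  · rw [div_le_iff₀ hn', Finset.sum_mul]
    refine le_trans (Nat.cast_le.2 hv) ((card_sub_le_sum _ _).trans (le_of_eq ?_))
    refine Finset.sum_congr rfl fun a _ => ?_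
    rw [← sub_div, abs_div, abs_of_pos hn', div_mul_cancel₀ _ hn'.ne']

/-! ### Sequences of types and the existence of the refinement -/

open scoped Classical in
/-- `s n` is a multiset of `n` letters, and the empirical distributions of these multisets
converge to `P`. -/
def HasTypeLimit {W : Type u} (s : ℕ → Multiset W) (P : W → ℝ) : Prop :=
  (∀ n, (s n).card = n) ∧
    ∀ a, Tendsto (fun n : ℕ => ((s n).count a : ℝ) / n) atTop (𝓝 (P a))

open scoped Classical in
/-- The image of a distribution under a map. -/
def pushforward {X Y : Type u} [Fintype X] (φ : X → Y) (P : X → ℝ) (y : Y) : ℝ :=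
  ∑ x, if φ x = y then P x else 0

open scoped Classical in
theorem HasTypeLimit.map {X Y : Type u} [Fintype X] {s : ℕ → Multiset X} {P : X → ℝ}
    (h : HasTypeLimit s P) (φ : X → Y) :
    HasTypeLimit (fun n => (s n).map φ) (pushforward φ P) := by
  refine ⟨fun n => by simp [h.1 n], fun y => ?_⟩
  have h1 : ∀ m : Multiset X,
      ((m.map φ).count y : ℝ) = ∑ x, if φ x = y then (m.count x : ℝ) else 0 := by
    intro m
    induction m using Multiset.induction_on with
    | empty => simp
    | cons a m ih =>
      rw [Multiset.map_cons, Multiset.count_cons, Nat.cast_add, ih]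
      simp_rw [Multiset.count_cons, Nat.cast_add, ite_add_zero (P := φ _ = y)]
      rw [Finset.sum_add_distrib]
      congr 1
      rw [Finset.sum_eq_single a]
      · simp [eq_comm]
      · intro b _ hb
        simp [hb]
      · simp
  simp_rw [h1, Finset.sum_div]
  refine tendsto_finsetSum _ fun x _ => ?_
  by_cases hx : φ x = y
  · simpa [hx] using h.2 x
  · simp [hx]

/-- Every distribution is a limit of types: round the expected numbers of letters down, and use
one fixed letter for what is missing. -/
theorem exists_hasTypeLimit {W : Type u} [Fintype W] {P : W → ℝ} (hP : P ∈ stdSimplex ℝ W) :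
    ∃ s, HasTypeLimit s P := by
  classical
  have hne : Nonempty W := by
    by_contra hc
    rw [not_nonempty_iff] at hc
    simpa using hP.2
  obtain ⟨b⟩ := hne
  have hsum : ∀ n : ℕ, ∑ a, ⌊n * P a⌋₊ ≤ n := fun n => by
    have h : ((∑ a, ⌊n * P a⌋₊ : ℕ) : ℝ) ≤ n := by
      push_cast
      calc ∑ a, (⌊n * P a⌋₊ : ℝ) ≤ ∑ a, n * P a :=
            Finset.sum_le_sum fun a _ => Nat.floor_le (mul_nonneg (Nat.cast_nonneg _) (hP.1 a))
        _ = n := by rw [← Finset.mul_sum, hP.2, mul_one]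
    exact_mod_cast h
  have hmiss : ∀ n : ℕ, ((n - ∑ a, ⌊n * P a⌋₊ : ℕ) : ℝ) ≤ Fintype.card W := fun n => by
    rw [Nat.cast_sub (hsum n)]
    push_cast
    have : (n : ℝ) ≤ ∑ a, ((⌊n * P a⌋₊ : ℝ) + 1) := by
      calc (n : ℝ) = ∑ a, n * P a := by rw [← Finset.mul_sum, hP.2, mul_one]
        _ ≤ _ := Finset.sum_le_sum fun a _ => (Nat.lt_floor_add_one _).le
    rw [Finset.sum_add_distrib] at this
    simp only [Finset.sum_const, Finset.card_univ, nsmul_eq_mul, mul_one] at this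
    linarith
  refine ⟨fun n => ∑ a, ⌊n * P a⌋₊ • {a} + (n - ∑ a, ⌊n * P a⌋₊) • {b}, fun n => ?_, fun a => ?_⟩
  · have := hsum n
    simp only [Multiset.card_add, Multiset.card_sum, Multiset.card_nsmul, Multiset.card_singleton,
      mul_one]
    omega
  · have hcount : ∀ n : ℕ, (((∑ a, ⌊n * P a⌋₊ • {a} + (n - ∑ a, ⌊n * P a⌋₊) • {b} :
        Multiset W).count a : ℕ) : ℝ)
        = ⌊n * P a⌋₊ + (n - ∑ a, ⌊n * P a⌋₊ : ℕ) * (if a = b then 1 else 0) := fun n => by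
      rw [Multiset.count_add, Multiset.count_sum', Multiset.count_nsmul]
      simp [Multiset.count_nsmul, Multiset.count_singleton]
    simp_rw [hcount, add_div]
    have h1 : Tendsto (fun n : ℕ => (⌊(n : ℝ) * P a⌋₊ : ℝ) / n) atTop (𝓝 (P a)) := by
      have := (tendsto_nat_floor_mul_div_atTop (R := ℝ) (hP.1 a)).comp tendsto_natCast_atTop_atTop
      refine this.congr fun n => ?_
      simp [mul_comm]
    have h2 : Tendsto (fun n : ℕ => ((n - ∑ a, ⌊n * P a⌋₊ : ℕ) : ℝ) * (if a = b then 1 else 0) / n)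
        atTop (𝓝 0) := by
      refine squeeze_zero (fun n => by positivity) (fun n => ?_)
        (tendsto_const_div_atTop_nhds_zero_nat (Fintype.card W : ℝ))
      gcongr
      refine (mul_le_of_le_one_right (Nat.cast_nonneg _) ?_).trans (hmiss n)
      split_ifs <;> norm_num
    simpa using h1.add h2

open scoped Classical in
theorem typeOf_eq_count {W : Type u} {n : ℕ} (x : Fin n → W) (a : W) :
    typeOf x a = ((List.ofFn x : Multiset W).count a : ℝ) / n := by
  rw [typeOf]
  congr 2
  rw [Multiset.coe_count]
  induction n with
  | zero => simp
  | succ n ih =>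
    rw [List.ofFn_succ, List.count_cons, ← ih (fun i => x i.succ), Finset.card_filter,
      Finset.card_filter, Fin.sum_univ_succ, add_comm]
    simp

open scoped Classical in
theorem val_typeGraph {W : Type u} [Finite W] (f : SpectralPoint.{u}) (H : SimpleGraph W) {n : ℕ}
    (hn : 0 < n) {Q : W → ℝ} {s : Multiset W} (h : ∀ a, Q a = (s.count a : ℝ) / n) :
    f.val (typeGraph H n Q) = classVal f H n s := by
  have hn' : (n : ℝ) ≠ 0 := by positivity
  have hset : {x : Fin n → W | typeOf x = Q} = {x | (List.ofFn x : Multiset W) = s} := by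
    ext x
    simp only [Set.mem_ofPred_eq, funext_iff, typeOf_eq_count, h, Multiset.ext]
    refine forall_congr' fun a => ?_
    rw [div_left_inj' hn', Nat.cast_inj]
  unfold typeGraph classVal
  rw [hset]

/-- Convergent sequences of types and convergent sequences of multisets of letters describe the same
limits. -/
theorem isRefinementLimit_iff {W : Type u} [Fintype W] (f : SpectralPoint.{u}) (H : SimpleGraph W)
    {P : W → ℝ} (hP : P ∈ stdSimplex ℝ W) (L : ℝ) :
    IsRefinementLimit f H P L ↔ ∀ s, HasTypeLimit s P →
      Tendsto (fun n : ℕ => 1 / (n : ℝ) * Real.logb 2 (classVal f H n (s n))) atTop (𝓝 L) := by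
  classical
  constructor
  · intro h s hs
    -- the empirical distribution of a string of length zero is not a distribution
    have h1 := h (fun n => if n = 0 then P else fun a => ((s n).count a : ℝ) / n) (fun n => ?_) ?_
    · refine h1.congr' ?_
      filter_upwards [eventually_gt_atTop 0] with n hn
      rw [val_typeGraph f H hn (s := s n) fun a => by rw [if_neg hn.ne']]
    · rcases Nat.eq_zero_or_pos n with rfl | hn
      · exact ⟨by simpa using hP, fun a => ⟨0, by simp⟩⟩
      · have hn' : (n : ℝ) ≠ 0 := by positivity
        rw [if_neg hn.ne']
        refine ⟨⟨fun a => by positivity, ?_⟩, fun a => ⟨(s n).count a, by field_simp⟩⟩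
        rw [← Finset.sum_div, ← Nat.cast_sum,
          Multiset.sum_count_eq_card (fun a _ => Finset.mem_univ a), hs.1 n, div_self hn']
    · rw [tendsto_pi_nhds]
      intro a
      refine (hs.2 a).congr' ?_
      filter_upwards [eventually_gt_atTop 0] with n hn
      rw [if_neg hn.ne']
  · intro h Q hQ hlim
    choose k hk using fun n => (hQ n).2
    have hcount : ∀ n a, (∑ b, k n b • ({b} : Multiset W)).count a = k n a := fun n a => by
      rw [Multiset.count_sum']
      simp [Multiset.count_nsmul, Multiset.count_singleton]
    have hs : HasTypeLimit (fun n => ∑ b, k n b • ({b} : Multiset W)) P := by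
      refine ⟨fun n => ?_, fun a => ?_⟩
      · have h1 : ((∑ b, k n b : ℕ) : ℝ) = n := by
          push_cast
          simp_rw [← hk, ← Finset.mul_sum, (hQ n).1.2, mul_one]
        simpa using (by exact_mod_cast h1 : ∑ b, k n b = n)
      · refine ((tendsto_pi_nhds.1 hlim) a).congr' ?_
        filter_upwards [eventually_gt_atTop 0] with n hn
        have hn' : (n : ℝ) ≠ 0 := by positivity
        rw [hcount, ← hk, mul_div_cancel_left₀ _ hn']
    refine (h _ hs).congr' ?_
    filter_upwards [eventually_gt_atTop 0] with n hn
    have hn' : (n : ℝ) ≠ 0 := by positivity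
    rw [val_typeGraph f H hn fun a => ?_]
    rw [hcount, ← hk, mul_div_cancel_left₀ _ hn']

theorem tendsto_mul_add_eta {ι : Type*} {l : Filter ι} {d : ι → ℝ} {t : ℝ} (c : ℝ)
    (hd : ∀ i, 0 ≤ d i) (ht : 0 ≤ t) (h : Tendsto d l (𝓝 t)) :
    Tendsto (fun i => d i * c + eta (d i)) l (𝓝 (t * c + eta t)) := by
  refine (h.mul_const c).add ?_
  exact (continuousOn_eta t ht).tendsto.comp
    (tendsto_nhdsWithin_iff.2 ⟨h, Eventually.of_forall hd⟩)

theorem exists_forall_mul_add_eta_lt (c : ℝ) {ε : ℝ} (hε : 0 < ε) :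
    ∃ δ > 0, ∀ d, 0 ≤ d → d < δ → d * c + eta d < ε := by
  have h : ContinuousWithinAt (fun d => d * c + eta d) (Set.Ici 0) 0 :=
    (continuousOn_id.mul_const c).add continuousOn_eta 0 Set.self_mem_Ici
  obtain ⟨δ, hδ, h⟩ := Metric.continuousWithinAt_iff.1 h ε hε
  refine ⟨δ, hδ, fun d hd hdδ => ?_⟩
  have := h (x := d) hd (by simpa [abs_of_nonneg hd] using hdδ)
  rw [zero_mul, eta_zero, add_zero, Real.dist_eq, sub_zero] at this
  exact (le_abs_self _).trans_lt this

/-- The normalized logarithm of the value of a type class. -/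
def classRate {W : Type u} [Finite W] (f : SpectralPoint.{u}) (H : SimpleGraph W)
    (s : ℕ → Multiset W) (n : ℕ) : ℝ :=
  1 / (n : ℝ) * Real.logb 2 (classVal f H n (s n))

theorem classRate_nonneg {W : Type u} [Fintype W] (f : SpectralPoint.{u}) (H : SimpleGraph W)
    {s : ℕ → Multiset W} {P : W → ℝ} (hs : HasTypeLimit s P) (n : ℕ) : 0 ≤ classRate f H s n :=
  mul_nonneg (by positivity) (Real.logb_nonneg one_lt_two (one_le_classVal f H (hs.1 n)))

theorem classRate_le {W : Type u} [Fintype W] [Nonempty W] (f : SpectralPoint.{u})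
    (H : SimpleGraph W) {s : ℕ → Multiset W} {P : W → ℝ} (hs : HasTypeLimit s P) (n : ℕ) :
    classRate f H s n ≤ Real.logb 2 (f.val H) := by
  have h0 : 0 ≤ Real.logb 2 (f.val H) := Real.logb_nonneg one_lt_two (f.one_le_val H)
  rcases Nat.eq_zero_or_pos n with rfl | hn
  · simpa [classRate] using h0
  have hn' : (0 : ℝ) < n := by exact_mod_cast hn
  rw [classRate, one_div, inv_mul_le_iff₀ hn', ← Real.logb_pow]
  exact Real.logb_le_logb_of_le one_lt_two
    (zero_lt_one.trans_le (one_le_classVal f H (hs.1 n))) (classVal_le_pow f H n _)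

/-- Repeating a multiset of `n` letters many times and adding fewer than `n` further letters gives
multisets of all large cardinalities `m` with almost the same empirical distribution, and the value
of their type classes is at least the corresponding power. -/
theorem eventually_classRate_le {W : Type u} [Fintype W] (f : SpectralPoint.{u})
    (H : SimpleGraph W) {s s' : ℕ → Multiset W} {P : W → ℝ} (hs : HasTypeLimit s P)
    (hs' : HasTypeLimit s' P) {ε : ℝ} (hε : 0 < ε) :
    ∀ᶠ n in atTop, ∀ᶠ m in atTop, classRate f H s n ≤ classRate f H s' m + ε := by
  classical
  have hne : Nonempty W := by
    obtain ⟨a, -⟩ := Multiset.card_pos_iff_exists_mem.1 (by rw [hs.1 1]; exact one_pos)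
    exact ⟨a⟩
  obtain ⟨b⟩ := id hne
  obtain ⟨δ, hδ, hmod⟩ := exists_forall_mul_add_eta_lt (Real.logb 2 (f.val H)) (half_pos hε)
  have hclose : Tendsto (fun n : ℕ => ∑ a, |((s n).count a : ℝ) / n - P a|) atTop (𝓝 0) := by
    rw [← Finset.sum_const_zero (s := (Finset.univ : Finset W))]
    refine tendsto_finsetSum _ fun a _ => ?_
    simpa using ((hs.2 a).sub_const (P a)).abs
  filter_upwards [hclose.eventually_lt_const hδ, eventually_gt_atTop 0] with n hn hn0
  have hn' : (0 : ℝ) < n := by exact_mod_cast hn0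
  set t : ℕ → Multiset W := fun m => (m / n) • s n + (m % n) • {b} with ht
  have htcard : ∀ m, (t m).card = m := fun m => by
    simp only [ht, Multiset.card_add, Multiset.card_nsmul, hs.1, Multiset.card_singleton, mul_one]
    exact Nat.div_add_mod' m n
  have hq : Tendsto (fun m : ℕ => ((m / n : ℕ) : ℝ) / m) atTop (𝓝 (1 / n)) := by
    have h1 := (tendsto_nat_floor_mul_div_atTop (R := ℝ) (a := 1 / n) (by positivity)).comp
      tendsto_natCast_atTop_atTop
    refine h1.congr fun m => ?_
    simp only [Function.comp]
    rw [one_div, inv_mul_eq_div, Nat.floor_div_natCast, Nat.floor_natCast]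
  have hr : Tendsto (fun m : ℕ => ((m % n : ℕ) : ℝ) / m) atTop (𝓝 0) := by
    refine squeeze_zero (fun m => by positivity) (fun m => ?_)
      (tendsto_const_div_atTop_nhds_zero_nat (n : ℝ))
    gcongr
    exact (Nat.mod_lt m hn0).le
  have htlim : ∀ a, Tendsto (fun m : ℕ => ((t m).count a : ℝ) / m) atTop
      (𝓝 ((s n).count a / n)) := fun a => by
    have h1 := (hq.mul_const ((s n).count a : ℝ)).add
      (hr.mul_const ((({b} : Multiset W).count a : ℕ) : ℝ))
    rw [zero_mul, add_zero, one_div_mul_eq_div] at h1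
    refine h1.congr fun m => ?_
    simp only [ht, Multiset.count_add, Multiset.count_nsmul, Nat.cast_add, Nat.cast_mul]
    ring
  have htclose : Tendsto (fun m : ℕ => ∑ a, |((t m).count a : ℝ) / m - (s' m).count a / m|) atTop
      (𝓝 (∑ a, |((s n).count a : ℝ) / n - P a|)) :=
    tendsto_finsetSum _ fun a _ => ((htlim a).sub (hs'.2 a)).abs
  have hlow : Tendsto (fun m : ℕ => ((m / n : ℕ) : ℝ) / m * Real.logb 2 (classVal f H n (s n)))
      atTop (𝓝 (classRate f H s n)) := hq.mul_const _
  filter_upwards [htclose.eventually_lt_const hn, eventually_gt_atTop 0,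
    hlow.eventually_const_lt (sub_lt_self _ (half_pos hε))] with m hm hm0 hlowm
  have hm' : (0 : ℝ) < m := by exact_mod_cast hm0
  obtain ⟨d, hd0, hd, hle⟩ := logb_classVal_le f H hm0 (htcard m) (hs'.1 m)
  have h1 := hmod d hd0 (hd.trans_lt hm)
  have h2 : classVal f H n (s n) ^ (m / n) ≤ classVal f H m (t m) := by
    have h3 := classVal_mul_le f H (m / n * n) (m % n) ((m / n) • s n) ((m % n) • {b})
    rw [Nat.div_add_mod'] at h3
    refine le_trans ?_ h3
    refine (classVal_pow_le f H n (m / n) (s n)).trans ?_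
    exact le_mul_of_one_le_right (classVal_nonneg _ _ _ _) (one_le_classVal f H (by simp))
  have h3 := Real.logb_le_logb_of_le one_lt_two
    (pow_pos (zero_lt_one.trans_le (one_le_classVal f H (hs.1 n))) _) h2
  rw [Real.logb_pow] at h3
  have h4 : ((m / n : ℕ) : ℝ) / m * Real.logb 2 (classVal f H n (s n))
      ≤ 1 / (m : ℝ) * Real.logb 2 (classVal f H m (t m)) := by
    rw [div_mul_eq_mul_div, one_div_mul_eq_div]
    gcongr
  rw [classRate] at hlowm ⊢
  rw [classRate]
  linarith

/-- The upper limit along one sequence of types is at most the lower limit along any other, so all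
sequences converge to the same limit. -/
theorem exists_isRefinementLimit {W : Type u} [Fintype W] (f : SpectralPoint.{u})
    (H : SimpleGraph W) {P : W → ℝ} (hP : P ∈ stdSimplex ℝ W) :
    ∃ L, IsRefinementLimit f H P L := by
  have hne : Nonempty W := by
    by_contra hc
    rw [not_nonempty_iff] at hc
    simpa using hP.2
  have hbdd : ∀ s, HasTypeLimit s P → BddAbove (Set.range (classRate f H s)) ∧
      BddBelow (Set.range (classRate f H s)) := fun s hs =>
    ⟨⟨_, Set.forall_mem_range.2 (classRate_le f H hs)⟩,
      ⟨0, Set.forall_mem_range.2 (classRate_nonneg f H hs)⟩⟩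
  have key : ∀ s s', HasTypeLimit s P → HasTypeLimit s' P →
      limsup (classRate f H s) atTop ≤ liminf (classRate f H s') atTop := by
    intro s s' hs hs'
    have b1 := (hbdd s hs).1.isBoundedUnder_of_range (f := atTop)
    have b2 := (hbdd s hs).2.isBoundedUnder_of_range (f := atTop)
    have b3 := (hbdd s' hs').1.isBoundedUnder_of_range (f := atTop)
    have b4 := (hbdd s' hs').2.isBoundedUnder_of_range (f := atTop)
    refine le_of_forall_pos_le_add fun ε hε => ?_
    refine limsup_le_of_le b2.isCoboundedUnder_le ?_
    filter_upwards [eventually_classRate_le f H hs hs' hε] with n hn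
    rw [← sub_le_iff_le_add]
    refine le_liminf_of_le b3.isCoboundedUnder_ge ?_
    filter_upwards [hn] with m hm
    linarith
  obtain ⟨s₀, hs₀⟩ := exists_hasTypeLimit hP
  refine ⟨limsup (classRate f H s₀) atTop, (isRefinementLimit_iff f H hP _).2 fun s hs => ?_⟩
  have b0 := (hbdd s₀ hs₀).1.isBoundedUnder_of_range (f := atTop)
  have b0' := (hbdd s₀ hs₀).2.isBoundedUnder_of_range (f := atTop)
  exact tendsto_of_le_liminf_of_limsup_le (key s₀ s hs₀ hs)
    ((key s s₀ hs hs₀).trans (liminf_le_limsup b0 b0'))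
    (hbdd s hs).1.isBoundedUnder_of_range (hbdd s hs).2.isBoundedUnder_of_range

theorem isRefinementLimit_refinement {W : Type u} [Fintype W] (f : SpectralPoint.{u})
    (H : SimpleGraph W) {P : W → ℝ} (hP : P ∈ stdSimplex ℝ W) :
    IsRefinementLimit f H P (refinement f H P) :=
  Classical.epsilon_spec (exists_isRefinementLimit f H hP)

theorem tendsto_classRate {W : Type u} [Fintype W] (f : SpectralPoint.{u})
    (H : SimpleGraph W) {s : ℕ → Multiset W} {P : W → ℝ} (hP : P ∈ stdSimplex ℝ W)
    (hs : HasTypeLimit s P) : Tendsto (classRate f H s) atTop (𝓝 (refinement f H P)) :=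
  (isRefinementLimit_iff f H hP _).1 (isRefinementLimit_refinement f H hP) s hs

/-! ### Subadditivity of the refinement -/

theorem pushforward_mem_stdSimplex {X Y : Type u} [Fintype X] [Fintype Y] {P : X → ℝ}
    (hP : P ∈ stdSimplex ℝ X) (φ : X → Y) : pushforward φ P ∈ stdSimplex ℝ Y := by
  refine ⟨fun y => Finset.sum_nonneg fun x _ => ?_, ?_⟩
  · split_ifs
    exacts [hP.1 x, le_rfl]
  · simp only [pushforward]
    rw [Finset.sum_comm, ← hP.2]
    refine Finset.sum_congr rfl fun x _ => ?_
    rw [Finset.sum_eq_single (φ x)] <;> simp +contextual [eq_comm]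

theorem refinement_nonneg {W : Type u} [Fintype W] (f : SpectralPoint.{u})
    (H : SimpleGraph W) {P : W → ℝ} (hP : P ∈ stdSimplex ℝ W) : 0 ≤ refinement f H P := by
  obtain ⟨s, hs⟩ := exists_hasTypeLimit hP
  exact ge_of_tendsto' (tendsto_classRate f H hP hs) fun n => classRate_nonneg f H hs n

/-- Subadditivity of the refinement with respect to the two marginals of `P`. -/
theorem refinement_le_add {X Y Z : Type u} [Fintype X] [Fintype Y] [Fintype Z]
    (f : SpectralPoint.{u}) {K : SimpleGraph Z} {H₁ : SimpleGraph X} {H₂ : SimpleGraph Y}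
    (a : Z → X) (b : Z → Y)
    (h : ∀ z z', Kᶜ.Adj z z' → H₁ᶜ.Adj (a z) (a z') ∨ H₂ᶜ.Adj (b z) (b z'))
    {P : Z → ℝ} (hP : P ∈ stdSimplex ℝ Z) :
    refinement f K P ≤ refinement f H₁ (pushforward a P) + refinement f H₂ (pushforward b P) := by
  obtain ⟨s, hs⟩ := exists_hasTypeLimit hP
  refine le_of_tendsto_of_tendsto' (tendsto_classRate f K hP hs)
    ((tendsto_classRate f H₁ (pushforward_mem_stdSimplex hP a) (hs.map a)).add
      (tendsto_classRate f H₂ (pushforward_mem_stdSimplex hP b) (hs.map b))) fun n => ?_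
  have hpos : ∀ {W : Type u} [Fintype W] (H : SimpleGraph W) (t : Multiset W), t.card = n →
      0 < classVal f H n t := fun H t ht => zero_lt_one.trans_le (one_le_classVal f H ht)
  have h1 := hpos H₁ ((s n).map a) (by simp [hs.1])
  have h2 := hpos H₂ ((s n).map b) (by simp [hs.1])
  rw [classRate, classRate, classRate, ← mul_add, ← Real.logb_mul h1.ne' h2.ne']
  refine mul_le_mul_of_nonneg_left ?_ (by positivity)
  exact Real.logb_le_logb_of_le one_lt_two (hpos K _ (hs.1 n)) (classVal_le_mul f a b h n (s n))

/-! ### The Ornstein distance and the refinement on strings -/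

theorem natCast_sum_map_eq {Z : Type u} [Fintype Z] [DecidableEq Z] (m : Multiset Z) (g : Z → ℕ) :
    (((m.map g).sum : ℕ) : ℝ) = ∑ z, (m.count z : ℝ) * g z := by
  induction m using Multiset.induction_on with
  | empty => simp
  | cons a m ih =>
    rw [Multiset.map_cons, Multiset.sum_cons, Nat.cast_add, ih]
    simp_rw [Multiset.count_cons, Nat.cast_add, add_mul]
    rw [Finset.sum_add_distrib, add_comm]
    simp

theorem normHamming_comm {V : Type u} {n : ℕ} (x y : Fin n → V) :
    normHamming x y = normHamming y x := by
  simp only [normHamming]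
  congr! 4
  exact ne_comm

theorem normHamming_nonneg {V : Type u} {n : ℕ} (x y : Fin n → V) : 0 ≤ normHamming x y := by
  unfold normHamming; positivity

theorem normHamming_le_one {V : Type u} {n : ℕ} (x y : Fin n → V) : normHamming x y ≤ 1 := by
  classical
  have h := (Finset.card_filter_le (Finset.univ : Finset (Fin n)) fun i => x i ≠ y i)
  rw [Finset.card_univ, Fintype.card_fin] at h
  rw [normHamming, one_div_mul_eq_div]
  refine div_le_one_of_le₀ (Nat.cast_le.2 ?_) (Nat.cast_nonneg n)
  convert h

theorem IsCoupling.symm {X : Type u} [Fintype X] {P Q : X → ℝ} {R : X × X → ℝ}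
    (h : IsCoupling P Q R) : IsCoupling Q P fun z => R z.swap := by
  refine ⟨⟨fun z => h.1.1 _, ?_⟩, fun x => h.2.2 x, fun y => h.2.1 y⟩
  rw [← h.1.2]
  exact Fintype.sum_equiv (Equiv.prodComm X X) _ _ fun z => rfl

theorem pushforward_fst_apply {X : Type u} [Fintype X] (R : X × X → ℝ) (x : X) :
    pushforward Prod.fst R x = ∑ y, R (x, y) := by
  rw [pushforward, Fintype.sum_prod_type, Finset.sum_eq_single x]
  · simp
  · intro b _ hb
    simp [hb]
  · simp

theorem pushforward_snd_apply {X : Type u} [Fintype X] (R : X × X → ℝ) (y : X) :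
    pushforward Prod.snd R y = ∑ x, R (x, y) := by
  rw [pushforward, Fintype.sum_prod_type]
  refine Finset.sum_congr rfl fun x _ => ?_
  rw [Finset.sum_eq_single y] <;> simp +contextual

theorem IsCoupling.pushforward_fst {X : Type u} [Fintype X] {P Q : X → ℝ} {R : X × X → ℝ}
    (h : IsCoupling P Q R) : pushforward Prod.fst R = P :=
  funext fun x => (pushforward_fst_apply R x).trans (h.2.1 x)

theorem IsCoupling.pushforward_snd {X : Type u} [Fintype X] {P Q : X → ℝ} {R : X × X → ℝ}
    (h : IsCoupling P Q R) : pushforward Prod.snd R = Q :=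
  funext fun y => (pushforward_snd_apply R y).trans (h.2.2 y)

theorem isCoupling_prod {X : Type u} [Fintype X] {P Q : X → ℝ} (hP : P ∈ stdSimplex ℝ X)
    (hQ : Q ∈ stdSimplex ℝ X) : IsCoupling P Q fun z => P z.1 * Q z.2 := by
  refine ⟨⟨fun z => mul_nonneg (hP.1 _) (hQ.1 _), ?_⟩, fun x => ?_, fun y => ?_⟩
  · rw [Fintype.sum_prod_type, ← Finset.sum_mul_sum, hP.2, hQ.2, one_mul]
  · simp only
    rw [← Finset.mul_sum, hQ.2, mul_one]
  · simp only
    rw [← Finset.sum_mul, hP.2, one_mul]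

/-- Joint types that converge to a coupling compare the type classes of their marginal types, at a
cost governed by the expected Hamming distance under the coupling. -/
theorem refinement_sub_le_of_isCoupling {V : Type u} [Fintype V] (f : SpectralPoint.{u})
    (G : SimpleGraph V) {n : ℕ} (hn : 0 < n) {P Q : (Fin n → V) → ℝ}
    (hP : P ∈ stdSimplex ℝ (Fin n → V)) (hQ : Q ∈ stdSimplex ℝ (Fin n → V))
    {R : (Fin n → V) × (Fin n → V) → ℝ} (hR : IsCoupling P Q R) (c : ℝ)
    (hc : c = ∑ x, ∑ y, R (x, y) * normHamming x y) :
    1 / (n : ℝ) * refinement f (strongPow G n) P - 1 / (n : ℝ) * refinement f (strongPow G n) Q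
      ≤ c * Real.logb 2 (f.val G) + eta c := by
  classical
  have hX : Nonempty (Fin n → V) := by
    by_contra h
    rw [not_nonempty_iff] at h
    simpa using hP.2
  have hV : Nonempty V := hX.map fun x => x ⟨0, hn⟩
  have hn' : (0 : ℝ) < n := by exact_mod_cast hn
  have : Nonempty (Fin n) := ⟨⟨0, hn⟩⟩
  obtain ⟨s, hs⟩ := exists_hasTypeLimit hR.1
  have hfst : HasTypeLimit (fun N => (s N).map Prod.fst) P := by
    rw [← hR.pushforward_fst]
    exact hs.map Prod.fst
  have hsnd : HasTypeLimit (fun N => (s N).map Prod.snd) Q := by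
    rw [← hR.pushforward_snd]
    exact hs.map Prod.snd
  set t : ℕ → ℝ := fun N => (((s N).map fun z => hammingDist (id z.1) (id z.2)).sum : ℕ) /
    (N * Fintype.card (Fin n) : ℕ) with ht
  have htlim : Tendsto t atTop (𝓝 c) := by
    have h1 : Tendsto (fun N => ∑ z : (Fin n → V) × (Fin n → V),
        ((s N).count z : ℝ) / N * normHamming z.1 z.2) atTop (𝓝 c) := by
      rw [hc, ← Fintype.sum_prod_type']
      refine tendsto_finsetSum _ fun z _ => ?_
      convert (hs.2 z).mul_const (normHamming z.1 z.2)
    refine h1.congr fun N => ?_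
    simp only [ht]
    rw [natCast_sum_map_eq, Finset.sum_div]
    refine Finset.sum_congr rfl fun z _ => ?_
    have hd : (hammingDist (id z.1) (id z.2) : ℝ) = n * normHamming z.1 z.2 := by
      rw [normHamming, ← mul_assoc, mul_one_div_cancel hn'.ne', one_mul, Nat.cast_inj, hammingDist]
      simp
    rw [hd, Fintype.card_fin, Nat.cast_mul]
    field_simp
  have htnn : ∀ N, 0 ≤ t N := fun N => by simp only [ht]; positivity
  have hc0 : 0 ≤ c := ge_of_tendsto' htlim htnn
  have hle : refinement f (strongPow G n) P
      ≤ n * (c * Real.logb 2 (f.val G) + eta c) + refinement f (strongPow G n) Q := by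
    refine le_of_tendsto_of_tendsto (tendsto_classRate f _ hP hfst)
      (((tendsto_mul_add_eta (Real.logb 2 (f.val G)) htnn hc0 htlim).const_mul (n : ℝ)).add
        (tendsto_classRate f _ hQ hsnd)) ?_
    filter_upwards [eventually_gt_atTop 0] with N hN
    have hN' : (0 : ℝ) < N := by exact_mod_cast hN
    have h := logb_classVal_map_fst_le f G (H := strongPow G n) id (compl_strongPow_adj G n) hN
      (s N) (hs.1 N) (t N) (rfl)
    rw [Fintype.card_fin, Nat.cast_mul] at h
    have h2 := mul_le_mul_of_nonneg_left h (by positivity : 0 ≤ 1 / (N : ℝ))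
    rw [classRate, classRate]
    refine h2.trans (le_of_eq ?_)
    field_simp
  rw [← mul_sub, one_div, inv_mul_le_iff₀ hn']
  linarith

theorem dbar_bddBelow {V : Type u} [Fintype V] {n : ℕ} (P Q : (Fin n → V) → ℝ) :
    BddBelow {c : ℝ | ∃ R : (Fin n → V) × (Fin n → V) → ℝ, IsCoupling P Q R ∧
      c = ∑ x, ∑ y, R (x, y) * normHamming x y} := by
  refine ⟨0, ?_⟩
  rintro c ⟨R, hR, rfl⟩
  exact Finset.sum_nonneg fun x _ => Finset.sum_nonneg fun y _ =>
    mul_nonneg (hR.1.1 _) (normHamming_nonneg _ _)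

theorem dbar_nonempty {V : Type u} [Fintype V] {n : ℕ} {P Q : (Fin n → V) → ℝ}
    (hP : P ∈ stdSimplex ℝ (Fin n → V)) (hQ : Q ∈ stdSimplex ℝ (Fin n → V)) :
    {c : ℝ | ∃ R : (Fin n → V) × (Fin n → V) → ℝ, IsCoupling P Q R ∧
      c = ∑ x, ∑ y, R (x, y) * normHamming x y}.Nonempty :=
  ⟨_, _, isCoupling_prod hP hQ, rfl⟩

theorem dbar_le {V : Type u} [Fintype V] {n : ℕ} {P Q : (Fin n → V) → ℝ}
    {R : (Fin n → V) × (Fin n → V) → ℝ} (hR : IsCoupling P Q R) :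
    dbar P Q ≤ ∑ x, ∑ y, R (x, y) * normHamming x y :=
  csInf_le (dbar_bddBelow P Q) ⟨R, hR, rfl⟩

theorem dbar_nonneg {V : Type u} [Fintype V] {n : ℕ} (P Q : (Fin n → V) → ℝ) : 0 ≤ dbar P Q := by
  refine Real.sInf_nonneg ?_
  rintro c ⟨R, hR, rfl⟩
  exact Finset.sum_nonneg fun x _ => Finset.sum_nonneg fun y _ =>
    mul_nonneg (hR.1.1 _) (normHamming_nonneg _ _)

theorem dbar_le_one {V : Type u} [Fintype V] {n : ℕ} {P Q : (Fin n → V) → ℝ}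
    (hP : P ∈ stdSimplex ℝ (Fin n → V)) (hQ : Q ∈ stdSimplex ℝ (Fin n → V)) : dbar P Q ≤ 1 := by
  have h := isCoupling_prod hP hQ
  refine (dbar_le h).trans ?_
  rw [← h.1.2, Fintype.sum_prod_type]
  exact Finset.sum_le_sum fun x _ => Finset.sum_le_sum fun y _ =>
    mul_le_of_le_one_right (h.1.1 (x, y)) (normHamming_le_one x y)

/-- Taking the infimum over couplings: the refinement on strings of length `n` is continuous in the
Ornstein distance. -/
theorem abs_refinement_sub_le {V : Type u} [Fintype V] (f : SpectralPoint.{u})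
    (G : SimpleGraph V) {n : ℕ} (hn : 0 < n) {P Q : (Fin n → V) → ℝ}
    (hP : P ∈ stdSimplex ℝ (Fin n → V)) (hQ : Q ∈ stdSimplex ℝ (Fin n → V)) :
    |1 / (n : ℝ) * refinement f (strongPow G n) P - 1 / (n : ℝ) * refinement f (strongPow G n) Q|
      ≤ dbar P Q * Real.logb 2 (f.val G) + eta (dbar P Q) := by
  obtain ⟨c, -, hclim, hc⟩ := exists_seq_tendsto_sInf (dbar_nonempty hP hQ) (dbar_bddBelow P Q)
  have hc0 : ∀ i, 0 ≤ c i := fun i => by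
    obtain ⟨R, hR, h⟩ := hc i
    rw [h]
    exact Finset.sum_nonneg fun x _ => Finset.sum_nonneg fun y _ =>
      mul_nonneg (hR.1.1 _) (normHamming_nonneg _ _)
  refine ge_of_tendsto' (tendsto_mul_add_eta _ hc0 (dbar_nonneg P Q) hclim) fun i => ?_
  obtain ⟨R, hR, h⟩ := hc i
  refine abs_sub_le_iff.2 ⟨refinement_sub_le_of_isCoupling f G hn hP hQ hR _ h,
    refinement_sub_le_of_isCoupling f G hn hQ hP hR.symm _ ?_⟩
  rw [h, Finset.sum_comm]
  simp only [Prod.swap, normHamming_comm]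

theorem sum_pushforward_mul {X Y : Type u} [Fintype X] [Fintype Y] (φ : X → Y) (P : X → ℝ)
    (g : Y → ℝ) : ∑ y, pushforward φ P y * g y = ∑ x, P x * g (φ x) := by
  simp only [pushforward, Finset.sum_mul]
  rw [Finset.sum_comm]
  refine Finset.sum_congr rfl fun x _ => ?_
  rw [Finset.sum_eq_single (φ x)] <;> simp +contextual [eq_comm]

theorem pushforward_pushforward {X Y Z : Type u} [Fintype X] [Fintype Y] (ψ : Y → Z) (φ : X → Y)
    (P : X → ℝ) : pushforward ψ (pushforward φ P) = pushforward (ψ ∘ φ) P := by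
  classical
  funext z
  have h := sum_pushforward_mul φ P fun y => if ψ y = z then 1 else 0
  simp only [mul_ite, mul_one, mul_zero] at h
  rw [pushforward, pushforward]
  convert h
  rfl

theorem IsCoupling.map {X Y : Type u} [Fintype X] [Fintype Y] {P Q : X → ℝ} {R : X × X → ℝ}
    (h : IsCoupling P Q R) (φ : X → Y) :
    IsCoupling (pushforward φ P) (pushforward φ Q) (pushforward (Prod.map φ φ) R) := by
  refine ⟨pushforward_mem_stdSimplex h.1 _, fun y => ?_, fun y => ?_⟩
  · rw [← pushforward_fst_apply, ← h.pushforward_fst, pushforward_pushforward,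
      pushforward_pushforward]
    rfl
  · rw [← pushforward_snd_apply, ← h.pushforward_snd, pushforward_pushforward,
      pushforward_pushforward]
    rfl

theorem natCast_mul_normHamming {V : Type u} [DecidableEq V] {n : ℕ} (x y : Fin n → V) :
    n * normHamming x y = ∑ i, if x i ≠ y i then (1 : ℝ) else 0 := by
  rw [Finset.sum_boole, normHamming]
  rcases Nat.eq_zero_or_pos n with rfl | hn
  · simp
  · have hn' : (n : ℝ) ≠ 0 := by positivity
    rw [← mul_assoc, mul_one_div_cancel hn', one_mul]
    congr!

theorem natCast_add_mul_normHamming {V : Type u} {m n : ℕ} (x y : Fin (m + n) → V) :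
    ((m + n : ℕ) : ℝ) * normHamming x y
      = m * normHamming (x ∘ Fin.castAdd n) (y ∘ Fin.castAdd n)
        + n * normHamming (x ∘ Fin.natAdd m) (y ∘ Fin.natAdd m) := by
  classical
  simp only [natCast_mul_normHamming, Fin.sum_univ_add, Function.comp]

/-- A coupling of distributions on strings of length `m + n` restricts to couplings of the
distributions of the first `m` and of the last `n` letters. -/
theorem dbar_superadditive {V : Type u} [Fintype V] {m n : ℕ} {P Q : (Fin (m + n) → V) → ℝ}
    (hP : P ∈ stdSimplex ℝ (Fin (m + n) → V)) (hQ : Q ∈ stdSimplex ℝ (Fin (m + n) → V)) :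
    m * dbar (pushforward (· ∘ Fin.castAdd n) P) (pushforward (· ∘ Fin.castAdd n) Q)
      + n * dbar (pushforward (· ∘ Fin.natAdd m) P) (pushforward (· ∘ Fin.natAdd m) Q)
      ≤ ((m + n : ℕ) : ℝ) * dbar P Q := by
  obtain ⟨c, -, hclim, hc⟩ := exists_seq_tendsto_sInf (dbar_nonempty hP hQ) (dbar_bddBelow P Q)
  refine ge_of_tendsto' (hclim.const_mul _) fun i => ?_
  obtain ⟨R, hR, h⟩ := hc i
  have key : ∀ {k : ℕ} (φ : (Fin (m + n) → V) → (Fin k → V)),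
      k * dbar (pushforward φ P) (pushforward φ Q)
        ≤ ∑ z : (Fin (m + n) → V) × (Fin (m + n) → V),
            R z * (k * normHamming (φ z.1) (φ z.2)) := fun {k} φ => by
    refine (mul_le_mul_of_nonneg_left (dbar_le (hR.map φ)) (Nat.cast_nonneg k)).trans (le_of_eq ?_)
    rw [← Fintype.sum_prod_type', sum_pushforward_mul (Prod.map φ φ) R
      fun z => normHamming z.1 z.2, Finset.mul_sum]
    exact Finset.sum_congr rfl fun z _ => mul_left_comm _ _ _
  refine (add_le_add (key _) (key _)).trans (le_of_eq ?_)
  rw [← Finset.sum_add_distrib, h, ← Fintype.sum_prod_type', Finset.mul_sum]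
  refine Finset.sum_congr rfl fun z _ => ?_
  rw [← mul_add, ← natCast_add_mul_normHamming]
  ring

/-! ### Stationary measures -/

theorem sum_measureReal_fiber {Ω X : Type u} [MeasurableSpace Ω] (μ : Measure Ω)
    [IsProbabilityMeasure μ] (T : Ω → X) (hT : ∀ x, MeasurableSet {w | T w = x}) (s : Finset X) :
    ∑ x ∈ s, μ.real {w | T w = x} = μ.real {w | T w ∈ s} := by
  rw [← measureReal_biUnion_finset _ fun x _ => hT x]
  · congr 1
    ext w
    simp
  · intro x _ y _ hxy
    refine Set.disjoint_left.2 fun w h1 h2 => hxy ?_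
    rw [← show T w = x from h1]
    exact h2

theorem marginal_eq {V : Type u} [MeasurableSpace V] (μ : Measure (ℕ → V)) (m n : ℕ)
    (x : Fin n → V) :
    marginal μ m n x = μ.real {w : ℕ → V | (fun i : Fin n => w (m + i)) = x} := by
  simp only [marginal, funext_iff]

theorem measurableSet_block {V : Type u} [MeasurableSpace V] [DiscreteMeasurableSpace V]
    (m n : ℕ) (x : Fin n → V) :
    MeasurableSet {w : ℕ → V | (fun i : Fin n => w (m + i)) = x} := by
  simp only [funext_iff, Set.ofPred_forall]
  exact MeasurableSet.iInter fun i =>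
    (MeasurableSet.of_discrete (s := {x i})).preimage (measurable_pi_apply (m + (i : ℕ)))

theorem marginal_mem_stdSimplex {V : Type u} [Fintype V] [MeasurableSpace V]
    [DiscreteMeasurableSpace V] (μ : Measure (ℕ → V)) [IsProbabilityMeasure μ] (m n : ℕ) :
    marginal μ m n ∈ stdSimplex ℝ (Fin n → V) := by
  refine ⟨fun x => measureReal_nonneg, ?_⟩
  simp only [marginal_eq]
  rw [sum_measureReal_fiber μ _ (measurableSet_block m n)]
  simp

theorem pushforward_marginal {V : Type u} [Fintype V] [MeasurableSpace V]
    [DiscreteMeasurableSpace V] (μ : Measure (ℕ → V)) [IsProbabilityMeasure μ] {m n k l : ℕ}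
    (φ : (Fin n → V) → (Fin k → V))
    (h : ∀ w : ℕ → V, φ (fun i : Fin n => w (m + i)) = fun j : Fin k => w (l + j)) :
    pushforward φ (marginal μ m n) = marginal μ l k := by
  classical
  funext y
  simp only [pushforward, marginal_eq, ← Finset.sum_filter]
  rw [sum_measureReal_fiber μ _ (measurableSet_block m n)]
  simp [h]

theorem pushforward_castAdd_initialMarginal {V : Type u} [Fintype V] [MeasurableSpace V]
    [DiscreteMeasurableSpace V] (μ : Measure (ℕ → V)) [IsProbabilityMeasure μ] (m n : ℕ) :
    pushforward (· ∘ Fin.castAdd n) (initialMarginal μ (m + n)) = initialMarginal μ m :=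
  pushforward_marginal μ _ fun _ => rfl

theorem pushforward_natAdd_initialMarginal {V : Type u} [Fintype V] [MeasurableSpace V]
    [DiscreteMeasurableSpace V] {μ : Measure (ℕ → V)} [IsProbabilityMeasure μ]
    (hμ : IsStationary μ) (m n : ℕ) :
    pushforward (· ∘ Fin.natAdd m) (initialMarginal μ (m + n)) = initialMarginal μ n := by
  rw [← hμ m n]
  exact pushforward_marginal μ _ fun w => by funext j; simp [Function.comp]

/-- Stationarity makes the sequence subadditive, because the last `n` of `m + n` letters are
distributed like the first `n`. -/
theorem tendsto_rate {V : Type u} [Fintype V] [MeasurableSpace V] [DiscreteMeasurableSpace V]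
    (f : SpectralPoint.{u}) (G : SimpleGraph V) {μ : Measure (ℕ → V)} [IsProbabilityMeasure μ]
    (hμ : IsStationary μ) :
    Tendsto (fun n : ℕ => 1 / (n : ℝ) * refinement f (strongPow G n) (initialMarginal μ n))
      atTop (𝓝 (rate f G μ)) := by
  have hsub : Subadditive fun n => refinement f (strongPow G n) (initialMarginal μ n) := by
    intro m n
    have h := refinement_le_add f (K := strongPow G (m + n)) (H₁ := strongPow G m)
      (H₂ := strongPow G n) (· ∘ Fin.castAdd n) (· ∘ Fin.natAdd m) (fun z z' h => by
        simp only [compl_strongPow_adj] at h ⊢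
        obtain ⟨i, hi⟩ := h
        refine Fin.addCases (fun i hi => Or.inl ⟨i, hi⟩) (fun i hi => Or.inr ⟨i, hi⟩) i hi)
      (marginal_mem_stdSimplex μ 0 (m + n))
    have h1 := pushforward_castAdd_initialMarginal μ m n
    have h2 := pushforward_natAdd_initialMarginal hμ m n
    rw [initialMarginal] at h1 h2
    rwa [h1, h2] at h
  have h := hsub.tendsto_lim ⟨0, Set.forall_mem_range.2 fun n =>
    div_nonneg (refinement_nonneg f _ (marginal_mem_stdSimplex μ 0 n)) (Nat.cast_nonneg n)⟩
  refine tendsto_nhds_limUnder ⟨_, h.congr fun n => ?_⟩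
  rw [one_div_mul_eq_div]

theorem tendsto_dbarInfinite {V : Type u} [Fintype V] [MeasurableSpace V]
    [DiscreteMeasurableSpace V] {μ ν : Measure (ℕ → V)} [IsProbabilityMeasure μ]
    [IsProbabilityMeasure ν] (hμ : IsStationary μ) (hν : IsStationary ν) :
    Tendsto (fun n : ℕ => dbar (initialMarginal μ n) (initialMarginal ν n))
      atTop (𝓝 (dbarInfinite μ ν)) := by
  have hsub : Subadditive fun n : ℕ => -(n * dbar (initialMarginal μ n) (initialMarginal ν n)) := by
    intro m n
    have h := dbar_superadditive (marginal_mem_stdSimplex μ 0 (m + n))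
      (marginal_mem_stdSimplex ν 0 (m + n))
    have h1 := pushforward_castAdd_initialMarginal μ m n
    have h2 := pushforward_natAdd_initialMarginal hμ m n
    have h3 := pushforward_castAdd_initialMarginal ν m n
    have h4 := pushforward_natAdd_initialMarginal hν m n
    rw [initialMarginal] at h1 h2 h3 h4
    rw [h1, h2, h3, h4] at h
    change _ ≤ ((m + n : ℕ) : ℝ) * dbar (initialMarginal μ (m + n)) (initialMarginal ν (m + n)) at h
    linarith
  have h := hsub.tendsto_lim ⟨-1, Set.forall_mem_range.2 fun n => by
    have hle := dbar_le_one (marginal_mem_stdSimplex μ 0 n) (marginal_mem_stdSimplex ν 0 n)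
    rw [neg_div, neg_le_neg_iff]
    refine div_le_one_of_le₀ ?_ (Nat.cast_nonneg n)
    exact mul_le_of_le_one_right (Nat.cast_nonneg n) hle⟩
  refine tendsto_nhds_limUnder ⟨_, h.neg.congr' ?_⟩
  filter_upwards [eventually_gt_atTop 0] with n hn
  have hn' : (n : ℝ) ≠ 0 := by positivity
  rw [neg_div, neg_neg, mul_div_cancel_left₀ _ hn']

theorem abs_rate_sub_le {V : Type u} [Fintype V] [MeasurableSpace V] [DiscreteMeasurableSpace V]
    (f : SpectralPoint.{u}) (G : SimpleGraph V) {μ ν : Measure (ℕ → V)} [IsProbabilityMeasure μ]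
    [IsProbabilityMeasure ν] (hμ : IsStationary μ) (hν : IsStationary ν) :
    |rate f G μ - rate f G ν| ≤ dbarInfinite μ ν * Real.logb 2 (f.val G)
      + eta (dbarInfinite μ ν) := by
  have hd := tendsto_dbarInfinite hμ hν
  have hd0 : ∀ n, 0 ≤ dbar (initialMarginal μ n) (initialMarginal ν n) := fun n => dbar_nonneg _ _
  refine le_of_tendsto_of_tendsto ((tendsto_rate f G hμ).sub (tendsto_rate f G hν)).abs
    (tendsto_mul_add_eta _ hd0 (ge_of_tendsto' hd hd0) hd) ?_
  filter_upwards [eventually_gt_atTop 0] with n hn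
  exact abs_refinement_sub_le f G hn (marginal_mem_stdSimplex μ 0 n)
    (marginal_mem_stdSimplex ν 0 n)

end AmbiguousSource

end

theorem mainTheorem4 {V : Type*} [Fintype V] (f : AmbiguousSource.SpectralPoint)
    (G : SimpleGraph V) :
    -- the probabilistic refinement is well defined
    (∀ (W : Type _) [Fintype W] (H : SimpleGraph W) (P : W → ℝ), P ∈ stdSimplex ℝ W →
      AmbiguousSource.IsRefinementLimit f H P (AmbiguousSource.refinement f H P)) ∧
    -- distributions on strings of length `n`
    (∀ (n : ℕ), 0 < n → ∀ P Q : (Fin n → V) → ℝ,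
      P ∈ stdSimplex ℝ (Fin n → V) → Q ∈ stdSimplex ℝ (Fin n → V) →
      |1 / (n : ℝ) * AmbiguousSource.refinement f (AmbiguousSource.strongPow G n) P
          - 1 / (n : ℝ) * AmbiguousSource.refinement f (AmbiguousSource.strongPow G n) Q|
        ≤ AmbiguousSource.dbar P Q * Real.logb 2 (f.val G)
          + 2 * AmbiguousSource.eta (AmbiguousSource.dbar P Q)) ∧
    -- stationary measures on infinite words; the limits defining the rates and the distance exist
    (∀ [MeasurableSpace V] [DiscreteMeasurableSpace V] (μ ν : Measure (ℕ → V))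
        [IsProbabilityMeasure μ] [IsProbabilityMeasure ν],
      AmbiguousSource.IsStationary μ → AmbiguousSource.IsStationary ν →
      Tendsto (fun n : ℕ => 1 / (n : ℝ) * AmbiguousSource.refinement f
          (AmbiguousSource.strongPow G n) (AmbiguousSource.initialMarginal μ n))
        atTop (𝓝 (AmbiguousSource.rate f G μ)) ∧
      Tendsto (fun n : ℕ => 1 / (n : ℝ) * AmbiguousSource.refinement f
          (AmbiguousSource.strongPow G n) (AmbiguousSource.initialMarginal ν n))
        atTop (𝓝 (AmbiguousSource.rate f G ν)) ∧
      Tendsto (fun n : ℕ => AmbiguousSource.dbar (AmbiguousSource.initialMarginal μ n)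
          (AmbiguousSource.initialMarginal ν n))
        atTop (𝓝 (AmbiguousSource.dbarInfinite μ ν)) ∧
      |AmbiguousSource.rate f G μ - AmbiguousSource.rate f G ν|
        ≤ AmbiguousSource.dbarInfinite μ ν * Real.logb 2 (f.val G)
          + 2 * AmbiguousSource.eta (AmbiguousSource.dbarInfinite μ ν)) := by
  open AmbiguousSource in
  refine ⟨fun W _ H P hP => isRefinementLimit_refinement f H hP, fun n hn P Q hP hQ => ?_,
    fun μ ν _ _ hμ hν => ⟨tendsto_rate f G hμ, tendsto_rate f G hν, tendsto_dbarInfinite hμ hν, ?_⟩⟩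
  · have h := eta_nonneg (dbar_nonneg P Q)
    linarith [abs_refinement_sub_le f G hn hP hQ]
  · have h := eta_nonneg (ge_of_tendsto' (tendsto_dbarInfinite hμ hν) fun n => dbar_nonneg _ _)
    linarith [abs_rate_sub_le f G hμ hν]
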